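/- **Model.** There are $n$ parties, of which a set of at most $f=\lfloor (n-1)/3\rfloor$ is corrupted before the execution (static Byzantine corruption). The network is asynchronous with authenticated channels, and there is a trusted setup. A probabilistic polynomial-time adversary schedules all events: it triggers the local steps that are enabled at honest parties and chooses their inputs, it sees all messages and outputs, delivers messages between honest parties in any order and with any delay but cannot alter them, and controls the corrupted parties. "Except with negligible probability" refers to the security parameter $\kappa$. "Eventually" refers to executions in which all messages between honest parties have been delivered. **Provable reliable broadcast (PRBC).** A protocol with a boolean function $\mathsf{PRBC.Verify}$ and, for each identifier $\mathsf{id}$, an instance $\mathsf{PRBC}[\mathsf{id}]$ with a designated sender; parties output pairs $(m,\sigma)$. However the adversary lets honest parties activate instances, the following hold for all $\mathsf{id}$ except with negligible probability. *Validity*: if all honest parties activate $\mathsf{PRBC}[\mathsf{id}]$ and the sender is honest with input $m$, then all honest parties eventually output $m$ with some $\sigma$ such that $\mathsf{PRBC.Verify}(\mathsf{id},\sigma)=1$. *Agreement*: if two honest parties output $m$ and $m'$ in $\mathsf{PRBC}[\mathsf{id}]$, then $m=m'$. *Totality*: if any party (even a malicious one) outputs $(m,\sigma)$ in $\mathsf{PRBC}[\mathsf{id}]$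 with $\mathsf{PRBC.Verify}(\mathsf{id},\sigma)=1$, and all honest parties activate $\mathsf{PRBC}[\mathsf{id}]$, then all honest parties eventually output some value with a valid proof. *Unforgeability*: as long as $f+1$ or more honest parties have not activated $\mathsf{PRBC}[\mathsf{id}]$, no party produces $\sigma$ with $\mathsf{PRBC.Verify}(\mathsf{id},\sigma)=1$. *Provability*: if an honest party outputs $(m,\sigma)$ in $\mathsf{PRBC}[\mathsf{id}]$, then $\mathsf{PRBC.Verify}(\mathsf{id},\sigma)=1$. **Bolt-RBC.** In $\mathsf{Bolt}[e]$ with leader $\mathcal P_l$ and batch size $B$, the designated sender of $\mathsf{PRBC}[\langle e,s\rangle]$ is $\mathcal P_l$ for all $s\ge 1$. Each honest party starts with $s=1$ and an empty log and repeats: activate $\mathsf{PRBC}[\langle e,s\rangle]$ (the leader with input the first $B$ transactions of its buffer); when $\mathsf{PRBC}[\langle e,s\rangle]$ returns $(\mathsf{TXs}_s,\mathsf{Proof}_s)$, append the block $\langle e,s,\mathsf{TXs}_s,\mathsf{Proof}_s\rangle$ to its log and set $s\leftarrow s+1$. Once $\mathsf{abandon}(e)$ is invoked at the party, it takes no further step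 in any $\mathsf{PRBC}[\langle e,\cdot\rangle]$. A block $\langle e,s,\mathsf{TXs},\mathsf{Proof}\rangle$ is *valid* if $\mathsf{Bolt.Verify}(e,s,\mathsf{Proof}):=\mathsf{PRBC.Verify}(\langle e,s\rangle,\mathsf{Proof})=1$. **Lemma.** If Bolt-RBC is run on a PRBC protocol, then each of the following properties holds except with negligible probability. 1. *Total-order.* If two honest parties have output logs $\mathsf{log}$ and $\mathsf{log}'$, then for all $1\le i\le\min\{|\mathsf{log}|,|\mathsf{log}'|\}$ the blocks $\mathsf{log}[i]$ and $\mathsf{log}'[i]$ have the same epoch, slot and transactions. If moreover each identifier has at most one valid proof under every honestly generated setup, then $\mathsf{log}[i]=\mathsf{log}'[i]$, including the proofs. 2. *Notarizability.* At every moment, if any party (even a malicious one) has output a valid block $\langle e,j,\cdot,\cdot\rangle$ at position $j\ge 2$ of its log, then at least $f+1$ honest parties have already output a valid block $\langle e,j-1,\cdot,\cdot\rangle$ at position $j-1$ of their logs. 3. *Abandonability.* (a) After the invocation of $\mathsf{abandon}(e)$ at an honest party, that party outputs no further block of $\mathsf{Bolt}[e]$. (b) Once $f+1$ honest parties have invoked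 $\mathsf{abandon}(e)$ without having activated $\mathsf{PRBC}[\langle e,s\rangle]$, no party ever outputs a valid block for slot $s$. (c) At any moment at which at least $f+1$ honest parties have invoked $\mathsf{abandon}(e)$: whenever any party outputs, then or at any other time, a valid block for a slot $s\ge 2$, one of these honest parties has by that moment already output a valid block for slot $s-1$. In particular, no valid block is ever output for a slot larger than $R+1$, where $R$ is the largest slot of a valid block output by that moment ($R=0$ if there is none). -/

import Mathlib

open Filter

namespace BoltRBC

/-! ## Bit strings and encodings -/

abbrev Bits := List Bool

/-- A sequence of transactions (each one a bit string). -/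
abbrev TxSeq := List Bits

/-- Session identifiers `⟨epoch, slot⟩`. -/
abbrev SessId := ℕ × ℕ

/-- Self-delimiting linear-size encoding of a list of strings: a bit `b` becomes `1b`, the end of
a string becomes `00`. -/
def encodeFrames (l : List Bits) : Bits :=
  l.flatMap fun w => w.flatMap (fun b => [true, b]) ++ [false, false]

/-- Total parser for `encodeFrames`. -/
def decodeFrames : Bits → List Bits
  | true :: b :: r =>
    match decodeFrames r with
    | [] => [[b]]
    | w :: ws => (b :: w) :: ws
  | false :: _ :: r => [] :: decodeFrames r
  | _ => []

theorem decodeFrames_encodeFrames (l : List Bits) : decodeFrames (encodeFrames l) = l := by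
  induction l with
  | nil => rfl
  | cons w ws ih =>
    have h : ∀ w : Bits, decodeFrames
        (w.flatMap (fun b => [true, b]) ++ false :: false :: encodeFrames ws) = w :: ws := by
      intro w
      induction w with
      | nil => simp [decodeFrames, ih]
      | cons b w ihw => simp [decodeFrames, ihw]
    simpa [encodeFrames] using h w

/-- Little-endian binary numeral to number; a left inverse of `Nat.bits`. -/
def bitsToNat (l : Bits) : ℕ := l.foldr (fun b k => Nat.bit b k) 0

/-! ## Provable reliable broadcast: syntax

A protocol for `n` parties that offers, for every identifier `id`, one broadcast instance with a
designated sender. All instances share one trusted setup. -/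

/-- What a party does in one local step of an instance: its new local state, the point-to-point
messages it sends, and possibly an output `(m, σ)`. -/
structure Reaction (n : ℕ) where
  state : Bits
  sent : List (Fin n × Bits)
  out : Option (TxSeq × Bits)

structure Protocol (n : ℕ) where
  /-- the designated sender of each instance -/
  sender : SessId → Fin n
  /-- trusted setup on security parameter `κ`: public parameters and one secret per party -/
  setup : ℕ → PMF (Bits × (Fin n → Bits))
  /-- code run by party `i` with secret `sk` when it activates instance `id`; the last argument is
  the input, which only the designated sender has -/
  onActivate : (pk sk : Bits) → (i : Fin n) → (id : SessId) → (input : Option TxSeq) →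
    PMF (Reaction n)
  /-- code run by party `i` in state `st` of instance `id` on a message `w` from party `j` -/
  onMessage : (pk sk : Bits) → (i : Fin n) → (id : SessId) → (st : Bits) → (j : Fin n) →
    (w : Bits) → PMF (Reaction n)
  /-- the publicly computable verification function (it may use the public parameters) -/
  verify : (pk : Bits) → (id : SessId) → (σ : Bits) → Bool

/-! ## The asynchronous system -/

/-- A message in transit; channels are authenticated, so `src` and `id` are genuine. -/
structure Msg (n : ℕ) where
  src : Fin n
  dst : Fin n
  id : SessId
  body : Bits

/-- Observable events. Those that carry a party index are events at honest parties. -/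
inductive Event (n : ℕ)
  /-- `i` activates instance `id` -/
  | activated (i : Fin n) (id : SessId) (input : Option TxSeq)
  /-- `i` outputs `(m, σ)` in instance `id` -/
  | output (i : Fin n) (id : SessId) (m : TxSeq) (σ : Bits)
  /-- a malicious party outputs `(m, σ)` for instance `id` -/
  | claimed (id : SessId) (m : TxSeq) (σ : Bits)
  /-- the buffer of pending transactions of `i` is now `txs` -/
  | buffer (i : Fin n) (txs : TxSeq)
  /-- `abandon(e)` is invoked at `i` -/
  | abandoned (i : Fin n) (e : ℕ)

/-- Global state: keys, local states of all instances that have been activated by honest parties,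
messages in transit, and the chronological list of all events so far. -/
structure Sys (n : ℕ) where
  pk : Bits
  sk : Fin n → Bits
  loc : Fin n → SessId → Option Bits
  pool : List (Msg n)
  trace : List (Event n)

/-- The adversary's possible moves. It schedules every event. -/
inductive Cmd (n : ℕ)
  /-- let honest party `i` activate instance `id` -/
  | activate (i : Fin n) (id : SessId) (input : Option TxSeq)
  /-- deliver the `k`-th message in transit -/
  | deliver (k : ℕ)
  /-- let corrupted party `j` send the message `w` of instance `id` to honest party `i` -/
  | inject (j i : Fin n) (id : SessId) (w : Bits)
  /-- let a malicious party output `(m, σ)` for instance `id` -/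
  | claim (id : SessId) (m : TxSeq) (σ : Bits)
  /-- set the transaction buffer of honest party `i` -/
  | setBuffer (i : Fin n) (txs : TxSeq)
  /-- invoke `abandon(e)` at honest party `i` -/
  | abandon (i : Fin n) (e : ℕ)

/-- Reads a party index in binary. -/
def readParty (n : ℕ) (w : Bits) : Option (Fin n) :=
  if h : bitsToNat w < n then some ⟨bitsToNat w, h⟩ else none

/-- Reads a move from a bit string; `none` is the decision to stop. -/
def Cmd.read (n : ℕ) (w : Bits) : Option (Cmd n) :=
  match decodeFrames w with
  | [] => none
  | t :: args =>
    match bitsToNat t, args with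
    | 0, [i, e, s] =>
      (readParty n i).map fun i => .activate i (bitsToNat e, bitsToNat s) none
    | 1, [i, e, s, m] =>
      (readParty n i).map fun i => .activate i (bitsToNat e, bitsToNat s) (some (decodeFrames m))
    | 2, [k] => some (.deliver (bitsToNat k))
    | 3, [j, i, e, s, b] =>
      (readParty n j).bind fun j => (readParty n i).map fun i =>
        .inject j i (bitsToNat e, bitsToNat s) b
    | 4, [e, s, m, σ] => some (.claim (bitsToNat e, bitsToNat s) (decodeFrames m) σ)
    | 5, [i, txs] => (readParty n i).map fun i => .setBuffer i (decodeFrames txs)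
    | 6, [i, e] => (readParty n i).map fun i => .abandon i (bitsToNat e)
    | _, _ => none

/-- Everything a local step reveals to the adversary: the output, if any, and all messages sent
(the channels are authenticated but not secret). -/
def Reaction.observation {n : ℕ} (r : Reaction n) : Bits :=
  encodeFrames ((match r.out with
    | none => [[false]]
    | some (m, σ) => [[true], encodeFrames m, σ]) ++
    r.sent.flatMap fun p => [Nat.bits p.1, p.2])

/-- The global state after party `i` has made the local step `r` in instance `id`; `evs` are
events to be recorded before the output. -/
def Sys.after {n : ℕ} (S : Sys n) (i : Fin n) (id : SessId) (evs : List (Event n))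
    (r : Reaction n) : Sys n :=
  { S with
    loc := fun j id' => if j = i ∧ id' = id then some r.state else S.loc j id'
    pool := S.pool ++ r.sent.map fun p => ⟨i, p.1, id, p.2⟩
    trace := S.trace ++ evs ++ match r.out with
      | none => []
      | some (m, σ) => [.output i id m σ] }

/-- One move, and what the adversary observes. Here `C` is the set of corrupted parties. Messages
that reach a party before it has activated the instance stay in transit. -/
noncomputable def Sys.step {n : ℕ} (R : Protocol n) (C : Finset (Fin n)) (S : Sys n) :
    Cmd n → PMF (Sys n × Bits)
  | .activate i id input =>
    if i ∉ C ∧ S.loc i id = none then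
      let inp := if i = R.sender id then input else none
      (R.onActivate S.pk (S.sk i) i id inp).map fun r =>
        (S.after i id [.activated i id inp] r, r.observation)
    else PMF.pure (S, [])
  | .deliver k =>
    match S.pool[k]? with
    | none => PMF.pure (S, [])
    | some μ =>
      match S.loc μ.dst μ.id with
      | none => PMF.pure (S, [])
      | some st =>
        (R.onMessage S.pk (S.sk μ.dst) μ.dst μ.id st μ.src μ.body).map fun r =>
          (({ S with pool := S.pool.eraseIdx k } : Sys n).after μ.dst μ.id [] r, r.observation)
  | .inject j i id w =>
    match S.loc i id with
    | none => PMF.pure (S, [])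
    | some st =>
      if j ∈ C then
        (R.onMessage S.pk (S.sk i) i id st j w).map fun r => (S.after i id [] r, r.observation)
      else PMF.pure (S, [])
  | .claim id m σ => PMF.pure ({ S with trace := S.trace ++ [.claimed id m σ] }, [])
  | .setBuffer i txs =>
    if i ∉ C then PMF.pure ({ S with trace := S.trace ++ [.buffer i txs] }, [])
    else PMF.pure (S, [])
  | .abandon i e =>
    if i ∉ C then PMF.pure ({ S with trace := S.trace ++ [.abandoned i e] }, [])
    else PMF.pure (S, [])

/-! ## Polynomial-time adversaries and executions -/

/-- A probabilistic polynomial-time adversary: a polynomial-time next-move function of its coins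
and everything it has seen, together with a polynomial that bounds, in the security parameter, the
number of its coins, the number of its moves and the length of each move. -/
structure Adversary where
  next : Bits → Bits
  polyTime : Nonempty (Turing.TM2ComputableInPolyTime (id : Bits → List Bool)
    (id : Bits → List Bool) next)
  bound : Polynomial ℕ

/-- Which moves the code run by the honest parties on top of the broadcast instances enables. -/
abbrev Guard (n : ℕ) := Sys n → Cmd n → Prop

open Classical in
/-- Runs the system for at most the given number of moves. The execution ends when the adversary
stops or asks for a move that is not enabled. -/
noncomputable def run {n : ℕ} (R : Protocol n) (A : Adversary) (C : Finset (Fin n)) (G : Guard n)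
    (maxLen : ℕ) : ℕ → Sys n → List Bits → PMF (Sys n)
  | 0, S, _ => PMF.pure S
  | fuel + 1, S, view =>
    match Cmd.read n ((A.next (encodeFrames view)).take maxLen) with
    | none => PMF.pure S
    | some c =>
      if G S c then
        (S.step R C c).bind fun p => run R A C G maxLen fuel p.1 (view ++ [p.2])
      else PMF.pure S

/-- The distribution of the final state of an execution with security parameter `κ`. The adversary
knows `κ` (in unary), its coins, the public parameters and the secrets of the corrupted parties. -/
noncomputable def exec {n : ℕ} (R : Protocol n) (A : Adversary) (C : Finset (Fin n)) (G : Guard n)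
    (κ : ℕ) : PMF (Sys n) :=
  (R.setup κ).bind fun keys =>
    (PMF.uniformOfFintype (Fin (A.bound.eval κ) → Bool)).bind fun coins =>
      run R A C G (A.bound.eval κ) (A.bound.eval κ)
        { pk := keys.1, sk := keys.2, loc := fun _ _ => none, pool := [], trace := [] }
        ([List.replicate κ true, List.ofFn coins, keys.1] ++
          List.ofFn fun i => if i ∈ C then keys.2 i else [])

/-- The number of tolerated corruptions. -/
def maxFaults (n : ℕ) : ℕ := (n - 1) / 3

/-- `P` holds except with negligible probability, whichever polynomial-time adversary runs the
system and whichever set of at most `maxFaults n` parties is (statically) corrupted. Here `G κ` is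
the code on top of the broadcast instances, and `P C κ S` a property of an execution. -/
def HoldsExceptNegligibly {n : ℕ} (R : Protocol n) (G : ℕ → Guard n)
    (P : Finset (Fin n) → ℕ → Sys n → Prop) : Prop :=
  ∀ (A : Adversary) (C : Finset (Fin n)), C.card ≤ maxFaults n →
    Asymptotics.SuperpolynomialDecay atTop (fun κ : ℕ => (κ : ℝ)) fun κ =>
      ((exec R A C (G κ) κ).toOuterMeasure {S | ¬ P C κ S}).toReal

/-! ## Provable reliable broadcast: security -/

section Security

variable {n : ℕ}

def Activated (tr : List (Event n)) (i : Fin n) (id : SessId) : Prop :=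
  ∃ input, Event.activated i id input ∈ tr

/-- Some party, honest or malicious, has output `(m, σ)` in instance `id`. -/
def Produced (tr : List (Event n)) (id : SessId) (m : TxSeq) (σ : Bits) : Prop :=
  (∃ i, Event.output i id m σ ∈ tr) ∨ Event.claimed id m σ ∈ tr

/-- No message of instance `id` between honest parties is in transit. Statements about what
happens eventually are statements about such executions. -/
def Quiescent (C : Finset (Fin n)) (S : Sys n) (id : SessId) : Prop :=
  ∀ μ ∈ S.pool, μ.id = id → μ.dst ∈ C

def Validity (R : Protocol n) (C : Finset (Fin n)) (S : Sys n) : Prop :=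
  ∀ id m, R.sender id ∉ C → Event.activated (R.sender id) id (some m) ∈ S.trace →
    (∀ i ∉ C, Activated S.trace i id) → Quiescent C S id →
    ∀ i ∉ C, ∃ σ, Event.output i id m σ ∈ S.trace ∧ R.verify S.pk id σ = true

def Agreement (C : Finset (Fin n)) (S : Sys n) : Prop :=
  ∀ id, ∀ i ∉ C, ∀ j ∉ C, i ≠ j → ∀ m m' σ σ',
    Event.output i id m σ ∈ S.trace → Event.output j id m' σ' ∈ S.trace → m = m'

def Totality (R : Protocol n) (C : Finset (Fin n)) (S : Sys n) : Prop :=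
  ∀ id m σ, Produced S.trace id m σ → R.verify S.pk id σ = true →
    (∀ i ∉ C, Activated S.trace i id) → Quiescent C S id →
    ∀ i ∉ C, ∃ m' σ', Event.output i id m' σ' ∈ S.trace ∧ R.verify S.pk id σ' = true

open Classical in
/-- At no moment is there a valid proof for an instance that `f + 1` or more honest parties have
not activated. -/
def Unforgeability (R : Protocol n) (C : Finset (Fin n)) (S : Sys n) : Prop :=
  ∀ tr, tr <+: S.trace → ∀ id,
    maxFaults n + 1 ≤ (Finset.univ.filter fun i => i ∉ C ∧ ¬ Activated tr i id).card →
    ¬ ∃ m σ, Produced tr id m σ ∧ R.verify S.pk id σ = true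

/-- The string that an honest party attaches to its output is a valid proof. -/
def Provability (R : Protocol n) (C : Finset (Fin n)) (S : Sys n) : Prop :=
  ∀ id, ∀ i ∉ C, ∀ m σ, Event.output i id m σ ∈ S.trace → R.verify S.pk id σ = true

/-- In the security definition nothing constrains when and on which input the honest parties
activate an instance: the adversary decides. -/
def anyUse : Guard n := fun _ _ => True

structure IsPRBC (R : Protocol n) : Prop where
  validity : HoldsExceptNegligibly R (fun _ => anyUse) fun C _ S => Validity R C S
  agreement : HoldsExceptNegligibly R (fun _ => anyUse) fun C _ S => Agreement C S
  totality : HoldsExceptNegligibly R (fun _ => anyUse) fun C _ S => Totality R C S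
  unforgeability : HoldsExceptNegligibly R (fun _ => anyUse) fun C _ S => Unforgeability R C S
  provability : HoldsExceptNegligibly R (fun _ => anyUse) fun C _ S => Provability R C S

/-- Under properly generated public parameters, an instance has at most one valid proof. -/
def UniqueProofs (R : Protocol n) : Prop :=
  ∀ κ, ∀ keys ∈ (R.setup κ).support, ∀ id σ σ',
    R.verify keys.1 id σ = true → R.verify keys.1 id σ' = true → σ = σ'

/-! ## The algorithm Bolt-RBC -/

structure Block where
  epoch : ℕ
  slot : ℕ
  txs : TxSeq
  proof : Bits

/-- Local variables of a party in `Bolt[e]`. -/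
structure Party where
  /-- current slot `s` -/
  slot : ℕ
  /-- whether the instance `⟨e, s⟩` of the current slot has been activated -/
  started : Bool
  /-- pending transactions, oldest first -/
  buf : TxSeq
  /-- the blocks returned so far -/
  log : List Block
  /-- whether `abandon(e)` has been invoked -/
  abandoned : Bool

def Party.init : Party := ⟨1, false, [], [], false⟩

/-- How the events at party `i` change its variables. The line **Commit** is the second one. -/
def Party.update (e : ℕ) (i : Fin n) (P : Party) : Event n → Party
  | .activated j id _ => if j = i ∧ id = (e, P.slot) then { P with started := true } else P
  | .output j id m σ =>
    if j = i ∧ id = (e, P.slot) then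
      { P with log := P.log ++ [⟨e, P.slot, m, σ⟩], slot := P.slot + 1, started := false }
    else P
  | .claimed _ _ _ => P
  | .buffer j txs => if j = i then { P with buf := txs } else P
  | .abandoned j e' => if j = i ∧ e' = e then { P with abandoned := true } else P

/-- The variables of party `i` in `Bolt[e]` after the events `tr`. -/
def party (e : ℕ) (tr : List (Event n)) (i : Fin n) : Party :=
  tr.foldl (Party.update e i) Party.init

/-- The code of `Bolt[e]` with leader `l` and batch size `B`.
* **Broadcast**: a party activates the instance `⟨e, s⟩` of its current slot `s`, once, on input
  the first `B` transactions of its buffer if it is the leader, and without input otherwise.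
* **Abandon**: after `abandon(e)` a party makes no step in any instance `⟨e, s⟩`.

Instances of other epochs are not constrained. -/
def boltCode (e : ℕ) (l : Fin n) (B : ℕ) : Guard n := fun S c =>
  match c with
  | .activate i id input => id.1 = e →
      (party e S.trace i).abandoned = false ∧
      (party e S.trace i).started = false ∧
      id.2 = (party e S.trace i).slot ∧
      input = if i = l then some ((party e S.trace i).buf.take B) else none
  | .deliver k => ∀ μ, S.pool[k]? = some μ → μ.id.1 = e →
      (party e S.trace μ.dst).abandoned = false
  | .inject _ i id _ => id.1 = e → (party e S.trace i).abandoned = false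
  | .claim _ _ _ => True
  | .setBuffer _ _ => True
  | .abandon _ _ => True

/-- `Bolt.Verify` -/
def boltVerify (R : Protocol n) (pk : Bits) (e s : ℕ) (proof : Bits) : Bool :=
  R.verify pk (e, s) proof

/-! ## Properties of notarizable weak atomic broadcast -/

/-- By the end of `tr`, honest party `i` has output the block `b` at position `j` of its log
(positions are counted from `1`), and `b = ⟨e, j, _, _⟩` is valid. -/
def HasValidBlock (R : Protocol n) (pk : Bits) (e : ℕ) (tr : List (Event n)) (i : Fin n) (j : ℕ)
    (b : Block) : Prop :=
  1 ≤ j ∧ (party e tr i).log[j - 1]? = some b ∧ b.epoch = e ∧ b.slot = j ∧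
    boltVerify R pk e j b.proof = true

/-- By the end of `tr`, some party, honest or malicious, has output a valid block at position
`j` of its log. -/
def ValidBlockOutput (R : Protocol n) (C : Finset (Fin n)) (pk : Bits) (e : ℕ)
    (tr : List (Event n)) (j : ℕ) : Prop :=
  (∃ i ∉ C, ∃ b, HasValidBlock R pk e tr i j b) ∨
    (1 ≤ j ∧ ∃ txs proof, Event.claimed (e, j) txs proof ∈ tr ∧
      boltVerify R pk e j proof = true)

/-- Logs of honest parties agree, position by position, on epoch, slot and transactions. -/
def TotalOrder (e : ℕ) (C : Finset (Fin n)) (S : Sys n) : Prop :=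
  ∀ i ∉ C, ∀ j ∉ C, ∀ (k : ℕ) (b b' : Block),
    (party e S.trace i).log[k]? = some b → (party e S.trace j).log[k]? = some b' →
    b.epoch = b'.epoch ∧ b.slot = b'.slot ∧ b.txs = b'.txs

/-- Logs of honest parties agree, position by position, on the blocks including their proofs. -/
def StrictTotalOrder (e : ℕ) (C : Finset (Fin n)) (S : Sys n) : Prop :=
  ∀ i ∉ C, ∀ j ∉ C, ∀ (k : ℕ) (b b' : Block),
    (party e S.trace i).log[k]? = some b → (party e S.trace j).log[k]? = some b' → b = b'

open Classical in
/-- At every moment, if some party has output a valid block at position `j ≥ 2`, then at least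
`f + 1` honest parties have already output a valid block at position `j - 1`. -/
def Notarizability (R : Protocol n) (e : ℕ) (C : Finset (Fin n)) (S : Sys n) : Prop :=
  ∀ tr, tr <+: S.trace → ∀ j, 2 ≤ j → ValidBlockOutput R C S.pk e tr j →
    maxFaults n + 1 ≤ (Finset.univ.filter fun i =>
      i ∉ C ∧ ∃ b, HasValidBlock R S.pk e tr i (j - 1) b).card

/-- After `abandon(e)` an honest party outputs no further block. -/
def SilentAfterAbandon (e : ℕ) (C : Finset (Fin n)) (S : Sys n) : Prop :=
  ∀ tr, tr <+: S.trace → ∀ i ∉ C, Event.abandoned i e ∈ tr →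
    (party e S.trace i).log = (party e tr i).log

open Classical in
/-- Once `f + 1` honest parties have invoked `abandon(e)` without having entered slot `s` (that
is, activated its broadcast instance), no party ever outputs a valid block for slot `s`. -/
def DeadSlots (R : Protocol n) (e : ℕ) (C : Finset (Fin n)) (S : Sys n) : Prop :=
  ∀ tr, tr <+: S.trace → ∀ s,
    maxFaults n + 1 ≤ (Finset.univ.filter fun i =>
      i ∉ C ∧ Event.abandoned i e ∈ tr ∧ ¬ Activated tr i (e, s)).card →
    ¬ ValidBlockOutput R C S.pk e S.trace s

open Classical in
/-- Once `f + 1` honest parties have invoked `abandon(e)`, a valid block for a slot `s ≥ 2` can be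
output, at any time, only if one of those parties had by then output a valid block for slot
`s - 1`. -/
def StoppedAfterAbandon (R : Protocol n) (e : ℕ) (C : Finset (Fin n)) (S : Sys n) : Prop :=
  ∀ tr, tr <+: S.trace →
    maxFaults n + 1 ≤ (Finset.univ.filter fun i => i ∉ C ∧ Event.abandoned i e ∈ tr).card →
    ∀ s, 2 ≤ s → ValidBlockOutput R C S.pk e S.trace s →
      ∃ i ∉ C, Event.abandoned i e ∈ tr ∧ ∃ b, HasValidBlock R S.pk e tr i (s - 1) b

def Abandonability (R : Protocol n) (e : ℕ) (C : Finset (Fin n)) (S : Sys n) : Prop :=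
  SilentAfterAbandon e C S ∧ DeadSlots R e C S ∧ StoppedAfterAbandon R e C S

end Security

end BoltRBC

namespace BoltRBC

section Analysis

variable {n : ℕ}

/-! ### Traces of the algorithm -/

/-! All the properties are safety properties, and the proof separates probability from
combinatorics.

Probability: a Bolt execution is an execution of the broadcast protocol against the same adversary,
cut off at the first move that the code does not enable. A violation of agreement, unforgeability or
provability cannot be undone by further events, so letting the adversary continue without the guard
only makes it more likely (`exec_toOuterMeasure_le`). A union bound over the three violations then
leaves a statement about single executions (`HoldsExceptNegligibly.of_safe`); no new adversary has
to be constructed.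

Combinatorics: in a legal trace, slot `s` is activated only when the slot counter equals `s`, hence
when `s - 1` blocks are already in the log, and provability makes their proofs valid
(`Safe.hasValidBlock`). A valid block for slot `j` leaves, by unforgeability, at most `f` honest
parties that have not activated `j`. At most `f` are corrupted, so at least `n - 2f ≥ f + 1` honest
parties have activated `j` and thus output `j - 1`. Abandoning freezes the set of activated
instances of the epoch, so `f + 1` abandoning parties that have not activated a slot block it
forever. Total order is agreement applied slot by slot. -/

theorem party_concat (e : ℕ) (tr : List (Event n)) (ev : Event n) (i : Fin n) :
    party e (tr ++ [ev]) i = (party e tr i).update e i ev := by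
  simp [party]

/-- Only a commit changes the log or the counter, and it changes both by one. This turns a bound on
the slot reached into a bound on the number of blocks output. -/
theorem party_slot (e : ℕ) (tr : List (Event n)) (i : Fin n) :
    (party e tr i).slot = (party e tr i).log.length + 1 := by
  induction tr using List.reverseRecOn with
  | nil => rfl
  | append_singleton tr ev ih =>
    rw [party_concat]
    cases ev <;> simp only [Party.update] <;> (try split_ifs) <;> simp [ih]

/-- The invocation of `abandon(e)` is recorded in the local variables. -/
theorem party_abandoned_eq_false_iff (e : ℕ) (tr : List (Event n)) (i : Fin n) :
    (party e tr i).abandoned = false ↔ Event.abandoned i e ∉ tr := by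
  induction tr using List.reverseRecOn with
  | nil => simp [party, Party.init]
  | append_singleton tr ev ih =>
    rw [party_concat]
    cases ev with
    | abandoned j e' =>
      simp only [Party.update]
      split_ifs with h
      · obtain ⟨rfl, rfl⟩ := h
        simp
      · have : ¬ (i = j ∧ e = e') := fun ⟨h₁, h₂⟩ => h ⟨h₁.symm, h₂.symm⟩
        simp [ih, this]
    | _ => simp only [Party.update]; (try split_ifs) <;> simp [ih]

/-- The log of a party only grows. -/
theorem party_log_mono (e : ℕ) {tr tr' : List (Event n)} (h : tr <+: tr') (i : Fin n) :
    (party e tr i).log <+: (party e tr' i).log := by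
  obtain ⟨u, rfl⟩ := h
  induction u using List.reverseRecOn with
  | nil => simp
  | append_singleton u ev ih =>
    rw [← List.append_assoc, party_concat]
    refine ih.trans ?_
    cases ev <;> simp only [Party.update] <;> (try split_ifs) <;> simp

theorem party_slot_mono (e : ℕ) {tr tr' : List (Event n)} (h : tr <+: tr') (i : Fin n) :
    (party e tr i).slot ≤ (party e tr' i).slot := by
  rw [party_slot, party_slot]
  have := (party_log_mono e h i).length_le
  omega

/-- Every block of a log stems from an output of the broadcast instance of its slot. -/
theorem output_of_mem_log {e : ℕ} {tr : List (Event n)} {i : Fin n} {k : ℕ} {b : Block}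
    (h : (party e tr i).log[k]? = some b) :
    b.epoch = e ∧ b.slot = k + 1 ∧ Event.output i (e, k + 1) b.txs b.proof ∈ tr := by
  induction tr using List.reverseRecOn with
  | nil => simp [party, Party.init] at h
  | append_singleton tr ev ih =>
    have old : (party e tr i).log[k]? = some b → b.epoch = e ∧ b.slot = k + 1 ∧
        Event.output i (e, k + 1) b.txs b.proof ∈ tr ++ [ev] := fun h' => by
      obtain ⟨h₁, h₂, h₃⟩ := ih h'
      exact ⟨h₁, h₂, List.mem_append_left _ h₃⟩
    rw [party_concat] at h
    cases ev with
    | output j id m σ =>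
      simp only [Party.update] at h
      split_ifs at h with hc
      · obtain ⟨rfl, rfl⟩ := hc
        simp only [List.getElem?_append, List.getElem?_singleton] at h
        split_ifs at h with h₁ h₂
        · exact old h
        -- The block just committed sits at index `k`, the old log length, and carries the old
        -- counter, which is `k + 1`.
        · have hk : k = (party e tr j).log.length := by omega
          obtain rfl := Option.some.inj h
          have hs := party_slot e tr j
          rw [← hk] at hs
          simp [hs]
      · exact old h
    | _ => exact old (by simp only [Party.update] at h; (try split_ifs at h) <;> exact h)

/-- The events at honest parties that the code of `Bolt[e]` permits after the events `tr`. -/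
def Permitted (e : ℕ) (tr : List (Event n)) : Event n → Prop
  | .activated i id _ => id.1 = e →
      Event.abandoned i e ∉ tr ∧ id.2 = (party e tr i).slot
  | .output i id _ _ => id.1 = e → Event.abandoned i e ∉ tr
  | _ => True

/-- Every event of the trace was permitted at its time. -/
def Legal (e : ℕ) (tr : List (Event n)) : Prop :=
  ∀ u ev, u ++ [ev] <+: tr → Permitted e u ev

theorem legal_nil (e : ℕ) : Legal e ([] : List (Event n)) := by
  intro u ev h
  simp at h

theorem Legal.concat {e : ℕ} {tr : List (Event n)} {ev : Event n} (h : Legal e tr)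
    (hev : Permitted e tr ev) : Legal e (tr ++ [ev]) := by
  intro u ev' hu
  rcases List.prefix_concat_iff.1 hu with hu | hu
  · obtain ⟨rfl, hev'⟩ := List.append_inj' hu rfl
    obtain rfl := List.singleton_inj.1 hev'
    exact hev
  · exact h u ev' hu

theorem Legal.of_prefix {e : ℕ} {tr tr' : List (Event n)} (h : Legal e tr') (hp : tr <+: tr') :
    Legal e tr := fun u ev hu => h u ev (hu.trans hp)

theorem exists_prefix_of_mem {tr : List (Event n)} {ev : Event n} (h : ev ∈ tr) :
    ∃ u, u ++ [ev] <+: tr := by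
  obtain ⟨u, v, rfl⟩ := List.append_of_mem h
  exact ⟨u, v, by simp⟩

/-- A party that has activated the instance of slot `s` has reached slot `s`. -/
theorem Legal.le_slot {e : ℕ} {tr : List (Event n)} (h : Legal e tr) {i : Fin n} {s : ℕ}
    (ha : Activated tr i (e, s)) : s ≤ (party e tr i).slot := by
  obtain ⟨inp, ha⟩ := ha
  obtain ⟨u, hu⟩ := exists_prefix_of_mem ha
  have hs : s = (party e u i).slot := (h u _ hu rfl).2
  rw [hs]
  exact party_slot_mono e ((List.prefix_append _ _).trans hu) i

/-- Instances of epoch `e` that a party activates at any time have been activated by the time it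
abandons the epoch. -/
theorem Legal.activated_of_abandoned {e : ℕ} {tr tr' : List (Event n)} (h : Legal e tr')
    (hp : tr <+: tr') {i : Fin n} {s : ℕ} (hi : Event.abandoned i e ∈ tr)
    (ha : Activated tr' i (e, s)) : Activated tr i (e, s) := by
  obtain ⟨inp, ha⟩ := ha
  obtain ⟨u, hu⟩ := exists_prefix_of_mem ha
  have hn : Event.abandoned i e ∉ u := (h u _ hu rfl).1
  -- The activation and the moment `tr` are comparable in time. If `tr` ended strictly before the
  -- activation, the abandonment would precede it, which legality excludes.
  rcases List.prefix_or_prefix_of_prefix hu hp with h' | h'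
  · exact ⟨inp, h'.subset (by simp)⟩
  · rcases List.prefix_concat_iff.1 h' with h' | h'
    · exact ⟨inp, by simp [h']⟩
    · exact absurd (h'.subset hi) hn

/-- A log grows only at an output in an instance of epoch `e`, and no such output is permitted after
the abandonment. -/
theorem Legal.log_eq_of_abandoned {e : ℕ} {tr tr' : List (Event n)} (h : Legal e tr')
    (hp : tr <+: tr') {i : Fin n} (hi : Event.abandoned i e ∈ tr) :
    (party e tr' i).log = (party e tr i).log := by
  obtain ⟨u, rfl⟩ := hp
  induction u using List.reverseRecOn with
  | nil => simp
  | append_singleton u ev ih =>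
    rw [← List.append_assoc] at h ⊢
    rw [← ih (h.of_prefix (List.prefix_append _ _)), party_concat]
    have hev := h _ _ (List.prefix_refl _)
    cases ev with
    | output j id m σ =>
      simp only [Party.update]
      split_ifs with hc
      · obtain ⟨rfl, rfl⟩ := hc
        exact absurd (List.mem_append_left _ hi) (hev rfl)
      · rfl
    | _ => simp only [Party.update] <;> (try split_ifs) <;> rfl

/-! ### Executions -/

/-- `S'` is a possible later state of an execution in state `S`, as far as observable. -/
def Sys.Extends (S' S : Sys n) : Prop := S'.pk = S.pk ∧ S.trace <+: S'.trace

theorem Sys.Extends.refl (S : Sys n) : S.Extends S := ⟨rfl, List.prefix_refl _⟩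

theorem Sys.Extends.trans {S₁ S₂ S₃ : Sys n} (h : S₃.Extends S₂) (h' : S₂.Extends S₁) :
    S₃.Extends S₁ := ⟨h.1.trans h'.1, h'.2.trans h.2⟩

theorem Sys.extends_of_mem_support_step {R : Protocol n} {C : Finset (Fin n)} {S : Sys n}
    {c : Cmd n} {p : Sys n × Bits} (hp : p ∈ (S.step R C c).support) : p.1.Extends S := by
  cases c <;> simp only [Sys.step] at hp <;> (try split at hp) <;> (try split at hp) <;>
    simp only [PMF.support_map, PMF.support_pure, Set.mem_image, Set.mem_singleton_iff] at hp <;>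
    first | subst hp | obtain ⟨r, -, rfl⟩ := hp
  all_goals exact ⟨rfl, by simp [Sys.after]⟩

/-- The output of a step is recorded after `evs`, so it has to be permitted at that point; on
activation, `evs` is the activation event of the same step. -/
theorem Legal.after {e : ℕ} {S : Sys n} {i : Fin n} {id : SessId} {evs : List (Event n)}
    {r : Reaction n} (h : Legal e (S.trace ++ evs))
    (ha : id.1 = e → Event.abandoned i e ∉ S.trace ++ evs) :
    Legal e (S.after i id evs r).trace := by
  simp only [Sys.after]
  split
  · simpa using h
  · exact h.concat ha

/-- Moves that the code of `Bolt[e]` enables lead to legal traces. -/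
theorem Legal.step {R : Protocol n} {C : Finset (Fin n)} {S : Sys n} {c : Cmd n} {e : ℕ}
    {l : Fin n} {B : ℕ} (h : Legal e S.trace) (hc : boltCode e l B S c) {p : Sys n × Bits}
    (hp : p ∈ (S.step R C c).support) : Legal e p.1.trace := by
  cases c with
  | activate i id input =>
    simp only [Sys.step] at hp
    split at hp
    · simp only [PMF.support_map, Set.mem_image] at hp
      obtain ⟨r, -, rfl⟩ := hp
      have ha : id.1 = e → Event.abandoned i e ∉ S.trace := fun hid =>
        (party_abandoned_eq_false_iff e _ i).1 (hc hid).1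
      refine Legal.after (h.concat fun hid => ⟨ha hid, (hc hid).2.2.1⟩) fun hid => ?_
      simpa using ha hid
    · rw [PMF.support_pure, Set.mem_singleton_iff] at hp
      subst hp
      exact h
  | deliver k =>
    simp only [Sys.step] at hp
    split at hp
    · rw [PMF.support_pure, Set.mem_singleton_iff] at hp
      subst hp
      exact h
    · rename_i μ hμ
      split at hp
      · rw [PMF.support_pure, Set.mem_singleton_iff] at hp
        subst hp
        exact h
      · simp only [PMF.support_map, Set.mem_image] at hp
        obtain ⟨r, -, rfl⟩ := hp
        refine Legal.after (by simpa using h) fun hid => ?_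
        simpa using (party_abandoned_eq_false_iff e _ _).1 (hc μ hμ hid)
  | inject j i id w =>
    simp only [Sys.step] at hp
    split at hp
    · rw [PMF.support_pure, Set.mem_singleton_iff] at hp
      subst hp
      exact h
    · split at hp
      · simp only [PMF.support_map, Set.mem_image] at hp
        obtain ⟨r, -, rfl⟩ := hp
        refine Legal.after (by simpa using h) fun hid => ?_
        simpa using (party_abandoned_eq_false_iff e _ _).1 (hc hid)
      · rw [PMF.support_pure, Set.mem_singleton_iff] at hp
        subst hp
        exact h
  | claim id m σ =>
    simp only [Sys.step, PMF.support_pure, Set.mem_singleton_iff] at hp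
    subst hp
    exact h.concat trivial
  | setBuffer i txs =>
    simp only [Sys.step] at hp
    split at hp <;> rw [PMF.support_pure, Set.mem_singleton_iff] at hp <;> subst hp
    · exact h.concat trivial
    · exact h
  | abandon i e' =>
    simp only [Sys.step] at hp
    split at hp <;> rw [PMF.support_pure, Set.mem_singleton_iff] at hp <;> subst hp
    · exact h.concat trivial
    · exact h

/-- A property of states that enabled moves preserve holds at the end of a run. -/
theorem run_invariant {R : Protocol n} {A : Adversary} {C : Finset (Fin n)} {G : Guard n}
    {maxLen : ℕ} {I : Sys n → Prop}
    (hI : ∀ S c p, I S → G S c → p ∈ (S.step R C c).support → I p.1)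
    (fuel : ℕ) (S : Sys n) (view : List Bits) (hS : I S) {S' : Sys n}
    (h : S' ∈ (run R A C G maxLen fuel S view).support) : I S' := by
  induction fuel generalizing S view with
  | zero =>
    rw [run, PMF.support_pure, Set.mem_singleton_iff] at h
    exact h ▸ hS
  | succ fuel ih =>
    rw [run] at h
    split at h
    · rw [PMF.support_pure, Set.mem_singleton_iff] at h
      exact h ▸ hS
    · split at h
      · rw [PMF.mem_support_bind_iff] at h
        obtain ⟨p, hp, h⟩ := h
        exact ih p.1 _ (hI _ _ _ hS ‹_› hp) h
      · rw [PMF.support_pure, Set.mem_singleton_iff] at h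
        exact h ▸ hS

theorem extends_of_mem_support_run {R : Protocol n} {A : Adversary} {C : Finset (Fin n)}
    {G : Guard n} {maxLen fuel : ℕ} {S S' : Sys n} {view : List Bits}
    (h : S' ∈ (run R A C G maxLen fuel S view).support) : S'.Extends S :=
  run_invariant (I := fun T => T.Extends S)
    (fun _ _ _ hI _ hp => (Sys.extends_of_mem_support_step hp).trans hI) fuel S view
    (Sys.Extends.refl S) h

/-- Stopping at once is compared with continuing: if `S` lies in the persistent event, every
continuation does too, and otherwise the left side is zero. -/
theorem pure_toOuterMeasure_le_run {R : Protocol n} {A : Adversary} {C : Finset (Fin n)}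
    {G : Guard n} {maxLen : ℕ} {E : Set (Sys n)}
    (hE : ∀ S S' : Sys n, S'.Extends S → S ∈ E → S' ∈ E) (fuel : ℕ) (S : Sys n)
    (view : List Bits) :
    (PMF.pure S).toOuterMeasure E ≤ (run R A C G maxLen fuel S view).toOuterMeasure E := by
  by_cases hS : S ∈ E
  · rw [((run R A C G maxLen fuel S view).toOuterMeasure_apply_eq_one_iff E).2
      fun S' h => hE S S' (extends_of_mem_support_run h) hS,
      ((PMF.pure S).toOuterMeasure_apply_eq_one_iff E).2 (by simpa using hS)]
  · simp [PMF.toOuterMeasure_pure_apply, hS]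

/-- An event that persists is at least as likely if the honest parties' use of the broadcast
instances is not constrained. -/
theorem run_toOuterMeasure_le {R : Protocol n} {A : Adversary} {C : Finset (Fin n)} {G : Guard n}
    {maxLen : ℕ} {E : Set (Sys n)} (hE : ∀ S S' : Sys n, S'.Extends S → S ∈ E → S' ∈ E)
    (fuel : ℕ) (S : Sys n) (view : List Bits) :
    (run R A C G maxLen fuel S view).toOuterMeasure E ≤
      (run R A C anyUse maxLen fuel S view).toOuterMeasure E := by
  induction fuel generalizing S view with
  | zero => simp [run]
  | succ fuel ih =>
    -- While moves are enabled, both runs make the same move and see the same observations, so the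
    -- induction hypothesis applies pointwise. Otherwise the guarded run stops in `S`.
    by_cases hG : ∃ c, Cmd.read n ((A.next (encodeFrames view)).take maxLen) = some c ∧ G S c
    · obtain ⟨c, hc, hG⟩ := hG
      have hany : anyUse S c := trivial
      simp only [run, hc, hG, hany, if_true, PMF.toOuterMeasure_bind_apply]
      refine ENNReal.tsum_le_tsum fun p => mul_le_mul_right (ih p.1 _) _
    · have : run R A C G maxLen (fuel + 1) S view = PMF.pure S := by
        rw [run]
        split
        · rfl
        · rename_i c hc
          rw [if_neg fun h => hG ⟨c, hc, h⟩]
      rw [this]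
      exact pure_toOuterMeasure_le_run hE _ _ _

theorem exec_toOuterMeasure_le {R : Protocol n} {A : Adversary} {C : Finset (Fin n)} {G : Guard n}
    {E : Set (Sys n)} (hE : ∀ S S' : Sys n, S'.Extends S → S ∈ E → S' ∈ E) (κ : ℕ) :
    (exec R A C G κ).toOuterMeasure E ≤ (exec R A C anyUse κ).toOuterMeasure E := by
  simp only [exec, PMF.toOuterMeasure_bind_apply]
  exact ENNReal.tsum_le_tsum fun keys => mul_le_mul_right (ENNReal.tsum_le_tsum fun coins =>
    mul_le_mul_right (run_toOuterMeasure_le hE _ _ _) _) _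

/-- The origin of the public parameters is kept because uniqueness of proofs is assumed only for
parameters that the setup can generate. -/
theorem exec_invariant {R : Protocol n} {A : Adversary} {C : Finset (Fin n)} {e : ℕ} {l : Fin n}
    {B κ : ℕ} {S : Sys n} (h : S ∈ (exec R A C (boltCode e l B) κ).support) :
    Legal e S.trace ∧ ∃ keys ∈ (R.setup κ).support, S.pk = keys.1 := by
  simp only [exec, PMF.mem_support_bind_iff] at h
  obtain ⟨keys, hk, coins, -, h⟩ := h
  exact ⟨run_invariant (I := fun S => Legal e S.trace) (fun _ _ _ hI hG hp => hI.step hG hp)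
    _ _ _ (legal_nil e) h, keys, hk, (extends_of_mem_support_run h).1⟩

/-! ### Reduction to the security of the broadcast protocol -/

/-- The safety properties of provable reliable broadcast. -/
structure Safe (R : Protocol n) (C : Finset (Fin n)) (S : Sys n) : Prop where
  agreement : Agreement C S
  unforgeability : Unforgeability R C S
  provability : Provability R C S

theorem Agreement.of_extends {C : Finset (Fin n)} {S S' : Sys n} (h : S'.Extends S)
    (hS : Agreement C S') : Agreement C S := fun id i hi j hj hij m m' σ σ' ho ho' =>
  hS id i hi j hj hij m m' σ σ' (h.2.subset ho) (h.2.subset ho')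

/-- Unforgeability speaks of every prefix of the trace; this is why a later activation cannot repair
a violation. -/
theorem Unforgeability.of_extends {R : Protocol n} {C : Finset (Fin n)} {S S' : Sys n}
    (h : S'.Extends S) (hS : Unforgeability R C S') : Unforgeability R C S :=
  fun tr htr id hcard => h.1 ▸ hS tr (htr.trans h.2) id hcard

theorem Provability.of_extends {R : Protocol n} {C : Finset (Fin n)} {S S' : Sys n}
    (h : S'.Extends S) (hS : Provability R C S') : Provability R C S :=
  fun id i hi m σ ho => h.1 ▸ hS id i hi m σ (h.2.subset ho)

/-- What follows, in legal executions, from the safety of the broadcast protocol holds except with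
negligible probability. -/
theorem HoldsExceptNegligibly.of_safe {R : Protocol n} (hR : IsPRBC R) {e : ℕ → ℕ}
    {l : ℕ → Fin n} {B : ℕ} {P : Finset (Fin n) → ℕ → Sys n → Prop}
    (hP : ∀ C κ S, C.card ≤ maxFaults n → Legal (e κ) S.trace →
      (∃ keys ∈ (R.setup κ).support, S.pk = keys.1) → Safe R C S → P C κ S) :
    HoldsExceptNegligibly R (fun κ => boltCode (e κ) (l κ) B) P := by
  intro A C hC
  have hsum := ((hR.agreement A C hC).add (hR.unforgeability A C hC)).add (hR.provability A C hC)
  refine hsum.trans_abs_le fun κ => ?_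
  set μ := (exec R A C (boltCode (e κ) (l κ) B) κ).toOuterMeasure with hμ
  set ν := (exec R A C anyUse κ).toOuterMeasure with hν
  have hfin : ∀ E, ν E ≠ ⊤ := fun E => by
    refine ne_top_of_le_ne_top ENNReal.one_ne_top ?_
    rw [hν, ← ((exec R A C anyUse κ).toOuterMeasure_apply_eq_one_iff Set.univ).2
      (Set.subset_univ _)]
    exact MeasureTheory.measure_mono (Set.subset_univ E)
  have hle : μ {S | ¬ P C κ S} ≤
      ν {S | ¬ Agreement C S} + ν {S | ¬ Unforgeability R C S} + ν {S | ¬ Provability R C S} :=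
    calc μ {S | ¬ P C κ S}
      _ ≤ μ (({S | ¬ Agreement C S} ∪ {S | ¬ Unforgeability R C S}) ∪
            {S | ¬ Provability R C S}) := by
          -- The inclusion is needed only on the support, where executions are legal and the keys
          -- come from the setup.
          refine PMF.toOuterMeasure_mono _ ?_
          rintro S ⟨hS, hsupp⟩
          by_contra hnot
          simp only [Set.mem_union, Set.mem_ofPred_eq, not_or, not_not] at hnot
          obtain ⟨hlegal, hkeys⟩ := exec_invariant hsupp
          exact hS (hP C κ S hC hlegal hkeys ⟨hnot.1.1, hnot.1.2, hnot.2⟩)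
      _ ≤ μ {S | ¬ Agreement C S} + μ {S | ¬ Unforgeability R C S} +
            μ {S | ¬ Provability R C S} :=
          (MeasureTheory.measure_union_le _ _).trans
            (add_le_add_left (MeasureTheory.measure_union_le _ _) _)
      -- Each of the three violations persists, so it is at least as likely in the unguarded
      -- execution.
      _ ≤ _ := by
          refine add_le_add (add_le_add ?_ ?_) ?_
          · exact exec_toOuterMeasure_le (fun _ _ h => mt (Agreement.of_extends h)) κ
          · exact exec_toOuterMeasure_le (fun _ _ h => mt (Unforgeability.of_extends h)) κ
          · exact exec_toOuterMeasure_le (fun _ _ h => mt (Provability.of_extends h)) κ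
  have hreal := ENNReal.toReal_mono (by simp [hfin]) hle
  rw [ENNReal.toReal_add (by simp [hfin]) (hfin _), ENNReal.toReal_add (hfin _) (hfin _)] at hreal
  rw [abs_of_nonneg ENNReal.toReal_nonneg]
  exact hreal.trans (le_abs_self _)

/-! ### Safe legal executions -/

theorem ValidBlockOutput.produced {R : Protocol n} {C : Finset (Fin n)} {pk : Bits} {e s : ℕ}
    {tr : List (Event n)} (h : ValidBlockOutput R C pk e tr s) :
    ∃ m σ, Produced tr (e, s) m σ ∧ R.verify pk (e, s) σ = true := by
  rcases h with ⟨i, -, b, hs, hb, -, -, hv⟩ | ⟨-, m, σ, hm, hv⟩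
  · have ho := (output_of_mem_log hb).2.2
    -- Positions count from `1` and list indices from `0`.
    rw [Nat.sub_add_cancel hs] at ho
    exact ⟨b.txs, b.proof, .inl ⟨i, ho⟩, hv⟩
  · exact ⟨m, σ, .inr hm, hv⟩

/-- An honest party that has entered slot `s ≥ 2` has output a valid block for slot `s - 1`. -/
theorem Safe.hasValidBlock {R : Protocol n} {C : Finset (Fin n)} {S : Sys n} (h : Safe R C S)
    {e s : ℕ} (hl : Legal e S.trace) {tr : List (Event n)} (htr : tr <+: S.trace) (hs : 2 ≤ s)
    {i : Fin n} (hi : i ∉ C) (ha : Activated tr i (e, s)) :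
    ∃ b, HasValidBlock R S.pk e tr i (s - 1) b := by
  have hslot := (hl.of_prefix htr).le_slot ha
  rw [party_slot] at hslot
  -- The counter is at least `s`, so the log has at least `s - 1 ≥ 1` blocks, and slot `s - 1` is
  -- stored at index `s - 2`.
  have hlt : s - 1 - 1 < (party e tr i).log.length := by omega
  have hget := List.getElem?_eq_getElem hlt
  obtain ⟨h₁, h₂, h₃⟩ := output_of_mem_log hget
  rw [Nat.sub_add_cancel (by omega : 1 ≤ s - 1)] at h₂ h₃
  exact ⟨_, by omega, hget, h₁, h₂, h.provability _ i hi _ _ (htr.subset h₃)⟩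

/-- The blocks at index `k` of both logs are outputs of the same instance `(e, k + 1)`. -/
theorem Safe.totalOrder {R : Protocol n} {C : Finset (Fin n)} {S : Sys n} (h : Safe R C S)
    (e : ℕ) : TotalOrder e C S := by
  intro i hi j hj k b b' hb hb'
  obtain ⟨h₁, h₂, h₃⟩ := output_of_mem_log hb
  obtain ⟨h₁', h₂', h₃'⟩ := output_of_mem_log hb'
  refine ⟨h₁.trans h₁'.symm, h₂.trans h₂'.symm, ?_⟩
  -- Agreement compares distinct parties; for a single party both blocks are the same log entry.
  by_cases hij : i = j
  · subst hij
    rw [Option.some.inj (hb.symm.trans hb')]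
  · exact h.agreement _ i hi j hj hij _ _ _ _ h₃ h₃'

theorem Safe.strictTotalOrder {R : Protocol n} {C : Finset (Fin n)} {S : Sys n} (h : Safe R C S)
    (hu : ∀ id σ σ', R.verify S.pk id σ = true → R.verify S.pk id σ' = true → σ = σ')
    (e : ℕ) : StrictTotalOrder e C S := by
  intro i hi j hj k b b' hb hb'
  obtain ⟨h₁, h₂, h₃⟩ := h.totalOrder e i hi j hj k b b' hb hb'
  have hp := hu _ _ _ (h.provability _ i hi _ _ (output_of_mem_log hb).2.2)
    (h.provability _ j hj _ _ (output_of_mem_log hb').2.2)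
  cases b
  cases b'
  simp_all

open Classical in
theorem Safe.notarizability {R : Protocol n} {C : Finset (Fin n)} {S : Sys n} (h : Safe R C S)
    {e : ℕ} (hl : Legal e S.trace) (hn : 0 < n) (hC : C.card ≤ maxFaults n) :
    Notarizability R e C S := by
  intro tr htr s hs hv
  -- Unforgeability is applied at the moment `tr` itself, so the activations it yields have already
  -- happened by then.
  have hlt := not_le.1 fun hle => h.unforgeability tr htr (e, s) hle hv.produced
  -- Every party is corrupted, has not activated slot `s`, or has output slot `s - 1`. The first two
  -- classes have at most `f` members each, and `3f < n` since `n` is positive.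
  have hcover : (Finset.univ : Finset (Fin n)) ⊆
      (C ∪ Finset.univ.filter fun i => i ∉ C ∧ ¬ Activated tr i (e, s)) ∪
        Finset.univ.filter fun i => i ∉ C ∧ ∃ b, HasValidBlock R S.pk e tr i (s - 1) b := by
    intro i _
    by_cases hi : i ∈ C
    · simp [hi]
    · by_cases ha : Activated tr i (e, s)
      · simp [hi, h.hasValidBlock hl htr hs hi ha]
      · simp [hi, ha]
  have h₁ := (Finset.card_le_card hcover).trans (Finset.card_union_le _ _)
  have h₂ := Finset.card_union_le C
    (Finset.univ.filter fun i => i ∉ C ∧ ¬ Activated tr i (e, s))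
  rw [Finset.card_univ, Fintype.card_fin] at h₁
  unfold maxFaults at *
  omega

open Classical in
-- Parties that abandoned without activating slot `s` still have not activated it at the end, so
-- unforgeability for the whole trace excludes a valid proof.
theorem Safe.deadSlots {R : Protocol n} {C : Finset (Fin n)} {S : Sys n} (h : Safe R C S)
    {e : ℕ} (hl : Legal e S.trace) : DeadSlots R e C S := by
  intro tr htr s hcard hv
  refine h.unforgeability S.trace (List.prefix_refl _) (e, s) (hcard.trans ?_) hv.produced
  refine Finset.card_le_card fun i hi => ?_
  simp only [Finset.mem_filter, Finset.mem_univ, true_and] at hi ⊢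
  exact ⟨hi.1, fun ha => hi.2.2 (hl.activated_of_abandoned htr hi.2.1 ha)⟩

open Classical in
theorem Safe.stoppedAfterAbandon {R : Protocol n} {C : Finset (Fin n)} {S : Sys n}
    (h : Safe R C S) {e : ℕ} (hl : Legal e S.trace) : StoppedAfterAbandon R e C S := by
  intro tr htr hcard s hs hv
  by_contra hnone
  refine h.unforgeability S.trace (List.prefix_refl _) (e, s) (hcard.trans ?_) hv.produced
  refine Finset.card_le_card fun i hi => ?_
  simp only [Finset.mem_filter, Finset.mem_univ, true_and] at hi ⊢
  -- An abandoning party that ever activates slot `s` did so within `tr`, and then it had output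
  -- slot `s - 1` by that moment, contrary to `hnone`.
  exact ⟨hi.1, fun ha => hnone ⟨i, hi.1, hi.2,
    h.hasValidBlock hl htr hs hi.1 (hl.activated_of_abandoned htr hi.2 ha)⟩⟩

theorem Safe.abandonability {R : Protocol n} {C : Finset (Fin n)} {S : Sys n} (h : Safe R C S)
    {e : ℕ} (hl : Legal e S.trace) : Abandonability R e C S :=
  ⟨fun _ htr _ _ hi => hl.log_eq_of_abandoned htr hi, h.deadSlots hl, h.stoppedAfterAbandon hl⟩

end Analysis

end BoltRBC

theorem mainTheorem5 {n : ℕ} (R : BoltRBC.Protocol n) (hR : BoltRBC.IsPRBC R)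
    (e : ℕ → ℕ) (l : ℕ → Fin n) (hl : ∀ κ s, 1 ≤ s → R.sender (e κ, s) = l κ) (B : ℕ) :
    BoltRBC.HoldsExceptNegligibly R (fun κ => BoltRBC.boltCode (e κ) (l κ) B)
        (fun C κ S => BoltRBC.TotalOrder (e κ) C S) ∧
      BoltRBC.HoldsExceptNegligibly R (fun κ => BoltRBC.boltCode (e κ) (l κ) B)
        (fun C κ S => BoltRBC.Notarizability R (e κ) C S) ∧
      BoltRBC.HoldsExceptNegligibly R (fun κ => BoltRBC.boltCode (e κ) (l κ) B)
        (fun C κ S => BoltRBC.Abandonability R (e κ) C S) ∧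
      (BoltRBC.UniqueProofs R →
        BoltRBC.HoldsExceptNegligibly R (fun κ => BoltRBC.boltCode (e κ) (l κ) B)
          (fun C κ S => BoltRBC.StrictTotalOrder (e κ) C S)) := by
  -- The existence of a leader makes the set of parties nonempty.
  have hn : 0 < n := (l 0).pos
  refine ⟨.of_safe hR fun C κ S _ _ _ h => h.totalOrder _,
    .of_safe hR fun C κ S hC hl _ h => h.notarizability hl hn hC,
    .of_safe hR fun C κ S _ hl _ h => h.abandonability hl,
    fun hu => .of_safe hR fun C κ S _ _ ⟨keys, hk, hpk⟩ h => h.strictTotalOrder ?_ _⟩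
  rw [hpk]
  exact hu κ keys hk
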